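/- Let $G$ be a finite metric graph with $N$ edges, the edge $e$ being identified with an interval $[0,L_e]$, $0<L_e<\infty$. Let $\hbar,c>0$, $m\in\mathbb R$, and $$\alpha=\begin{pmatrix}0&0&0&-i\\0&0&i&0\\0&-i&0&0\\i&0&0&0\end{pmatrix},\qquad \beta=\mathrm{diag}(1,1,-1,-1).$$ On the Hilbert space $\mathcal H=\bigoplus_{e}L^2(0,L_e)\otimes\mathbb C^4$ consider the free Dirac operator acting on each edge by $$(\mathcal D f)^e=-i\hbar c\,\alpha\,\frac{d f^e}{dx_e}+mc^2\beta f^e ,$$ where $f=(f^1,\dots,f^N)$ belongs to the Sobolev space $W(G)\otimes\mathbb C^4$ of spinors all of whose components lie, together with their weak first derivatives, in $L^2(0,L_e)$. Such $f^e$ are identified with their continuous representatives on $[0,L_e]$. Let $\mathcal D^0$ be the restriction of $\mathcal D$ to those $f$ with $f^e(0)=f^e(L_e)=0$ for all $e$. A self-adjoint realization of the Dirac operator on $G$ is a self-adjoint operator in $\mathcal H$ that extends $\mathcal D^0$ and is a restriction of $\mathcal D$ to a subspace of $W(G)\otimes\mathbb C^4$. Define the boundary vectors $\mathbf f_\pm\in\mathbb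 C^{4N}$ by $$\mathbf f_+^T=\bigl(f_1^1(0),f_2^1(0),\dots,f_1^N(0),f_2^N(0),\,f_1^1(L_1),f_2^1(L_1),\dots,f_1^N(L_N),f_2^N(L_N)\bigr),$$ $$\mathbf f_-^T=\bigl(-f_4^1(0),f_3^1(0),\dots,-f_4^N(0),f_3^N(0),\,f_4^1(L_1),-f_3^1(L_1),\dots,f_4^N(L_N),-f_3^N(L_N)\bigr).$$ Theorem. Let $\mathbb A,\mathbb B$ be complex $4N\times 4N$ matrices. The restriction of $\mathcal D$ to the domain $$\{f\in W(G)\otimes\mathbb C^4:\ \mathbb A\,\mathbf f_++\mathbb B\,\mathbf f_-=0\}$$ is a self-adjoint realization of the Dirac operator on $G$ if and only if $$\operatorname{rank}(\mathbb A,\mathbb B)=4N\quad\text{and}\quad \mathbb A\mathbb B^\dagger=\mathbb B\mathbb A^\dagger ,$$ where $(\mathbb A,\mathbb B)$ is the $4N\times 8N$ matrix with blocks $\mathbb A$ and $\mathbb B$. -/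

import Mathlib

open MeasureTheory Complex
open scoped ContDiff Matrix

noncomputable section

namespace QuantumGraph

/-- A compact metric graph with vertex set `V` and `N` edges: the edge `e` runs from the vertex
`source e` to the vertex `target e` and is identified with the interval `[0, length e]`, with
`x = 0` at `source e` and `x = length e` at `target e`. -/
structure MetricGraph (V : Type*) (N : ℕ) where
  source : Fin N → V
  target : Fin N → V
  length : Fin N → ℝ
  length_pos : ∀ e, 0 < length e

/-- The space `ℂ⁴` of four-component spinors, with its Hermitian inner product. -/
abbrev Spinor := EuclideanSpace ℂ (Fin 4)

/-- Spinor-valued square integrable functions `L²(0, ℓ) ⊗ ℂ⁴` on an edge of length `ℓ`. -/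
abbrev EdgeL2 (ℓ : ℝ) := Lp Spinor 2 (volume.restrict (Set.Ioo 0 ℓ))

/-- The Hilbert space `L²(G) ⊗ ℂ⁴ = ⨁ₑ L²(0, Lₑ) ⊗ ℂ⁴`. -/
abbrev GraphL2 {V : Type*} {N : ℕ} (G : MetricGraph V N) :=
  PiLp 2 (fun e : Fin N => EdgeL2 (G.length e))

/-! ### The Sobolev space of an edge -/

/-- `g` is the weak (distributional) derivative of `f` on `(0, ℓ)`. -/
def IsWeakDeriv {ℓ : ℝ} (f g : EdgeL2 ℓ) : Prop :=
  ∀ φ : ℝ → ℝ, ContDiff ℝ ∞ φ → HasCompactSupport φ → tsupport φ ⊆ Set.Ioo 0 ℓ →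
    ∫ x in Set.Ioo 0 ℓ, deriv φ x • f x = -∫ x in Set.Ioo 0 ℓ, φ x • g x

theorem integrable_smul {ℓ : ℝ} (f : EdgeL2 ℓ) {φ : ℝ → ℝ} (hφ : Continuous φ)
    (hc : HasCompactSupport φ) :
    Integrable (fun x => φ x • f x) (volume.restrict (Set.Ioo 0 ℓ)) := by
  have hf : Integrable f (volume.restrict (Set.Ioo 0 ℓ)) := (Lp.memLp f).integrable (by norm_num)
  obtain ⟨C, hC⟩ := hφ.bounded_above_of_compact_support hc
  exact hf.bdd_smul C hφ.aestronglyMeasurable (Filter.Eventually.of_forall hC)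

theorem integrable_deriv_smul {ℓ : ℝ} (f : EdgeL2 ℓ) {φ : ℝ → ℝ} (hφ : ContDiff ℝ ∞ φ)
    (hc : HasCompactSupport φ) :
    Integrable (fun x => deriv φ x • f x) (volume.restrict (Set.Ioo 0 ℓ)) :=
  integrable_smul f (hφ.continuous_deriv (by simp)) hc.deriv

theorem IsWeakDeriv.add {ℓ : ℝ} {f₁ f₂ g₁ g₂ : EdgeL2 ℓ} (h₁ : IsWeakDeriv f₁ g₁)
    (h₂ : IsWeakDeriv f₂ g₂) : IsWeakDeriv (f₁ + f₂) (g₁ + g₂) := by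
  intro φ hφ hc hs
  have e₁ : ∫ x in Set.Ioo 0 ℓ, deriv φ x • (f₁ + f₂) x =
      ∫ x in Set.Ioo 0 ℓ, (deriv φ x • f₁ x + deriv φ x • f₂ x) := by
    refine integral_congr_ae ?_
    filter_upwards [Lp.coeFn_add f₁ f₂] with x hx
    rw [hx, Pi.add_apply, smul_add]
  have e₂ : ∫ x in Set.Ioo 0 ℓ, φ x • (g₁ + g₂) x =
      ∫ x in Set.Ioo 0 ℓ, (φ x • g₁ x + φ x • g₂ x) := by
    refine integral_congr_ae ?_
    filter_upwards [Lp.coeFn_add g₁ g₂] with x hx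
    rw [hx, Pi.add_apply, smul_add]
  rw [e₁, e₂, integral_add (integrable_deriv_smul f₁ hφ hc) (integrable_deriv_smul f₂ hφ hc),
    integral_add (integrable_smul g₁ hφ.continuous hc) (integrable_smul g₂ hφ.continuous hc),
    h₁ φ hφ hc hs, h₂ φ hφ hc hs, neg_add]

theorem IsWeakDeriv.smul {ℓ : ℝ} {f g : EdgeL2 ℓ} (a : ℂ) (h : IsWeakDeriv f g) :
    IsWeakDeriv (a • f) (a • g) := by
  intro φ hφ hc hs
  have e₁ : ∫ x in Set.Ioo 0 ℓ, deriv φ x • (a • f) x =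
      ∫ x in Set.Ioo 0 ℓ, a • (deriv φ x • f x) := by
    refine integral_congr_ae ?_
    filter_upwards [Lp.coeFn_smul a f] with x hx
    rw [hx, Pi.smul_apply, smul_comm]
  have e₂ : ∫ x in Set.Ioo 0 ℓ, φ x • (a • g) x =
      ∫ x in Set.Ioo 0 ℓ, a • (φ x • g x) := by
    refine integral_congr_ae ?_
    filter_upwards [Lp.coeFn_smul a g] with x hx
    rw [hx, Pi.smul_apply, smul_comm]
  rw [e₁, e₂, integral_smul, integral_smul, h φ hφ hc hs, smul_neg]

theorem isWeakDeriv_zero {ℓ : ℝ} : IsWeakDeriv (0 : EdgeL2 ℓ) 0 := by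
  intro φ hφ hc hs
  have e₁ : ∫ x in Set.Ioo 0 ℓ, deriv φ x • (0 : EdgeL2 ℓ) x = 0 := by
    refine integral_eq_zero_of_ae ?_
    filter_upwards [Lp.coeFn_zero Spinor 2 (volume.restrict (Set.Ioo 0 ℓ))] with x hx
    rw [hx]; simp
  have e₂ : ∫ x in Set.Ioo 0 ℓ, φ x • (0 : EdgeL2 ℓ) x = 0 := by
    refine integral_eq_zero_of_ae ?_
    filter_upwards [Lp.coeFn_zero Spinor 2 (volume.restrict (Set.Ioo 0 ℓ))] with x hx
    rw [hx]; simp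
  rw [e₁, e₂, neg_zero]

theorem IsWeakDeriv.unique {ℓ : ℝ} {f g₁ g₂ : EdgeL2 ℓ} (h₁ : IsWeakDeriv f g₁)
    (h₂ : IsWeakDeriv f g₂) : g₁ = g₂ := by
  have hi : ∀ g : EdgeL2 ℓ, IntegrableOn g (Set.Ioo 0 ℓ) :=
    fun g => (Lp.memLp g).integrable (by norm_num)
  have key : ∀ᵐ x, x ∈ Set.Ioo 0 ℓ → (fun x => g₁ x - g₂ x) x = 0 := by
    refine isOpen_Ioo.ae_eq_zero_of_integral_contDiff_smul_eq_zero
      (((hi g₁).sub (hi g₂)).locallyIntegrableOn) ?_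
    intro φ hφ hc hs
    have e : ∫ x, φ x • (g₁ x - g₂ x) = ∫ x in Set.Ioo 0 ℓ, φ x • (g₁ x - g₂ x) := by
      refine (setIntegral_eq_integral_of_forall_compl_eq_zero ?_).symm
      intro x hx
      rw [image_eq_zero_of_notMem_tsupport (fun h => hx (hs h)), zero_smul]
    rw [e]
    simp only [smul_sub]
    rw [integral_sub (integrable_smul g₁ hφ.continuous hc) (integrable_smul g₂ hφ.continuous hc),
      sub_eq_zero]
    exact neg_injective ((h₁ φ hφ hc hs).symm.trans (h₂ φ hφ hc hs))
  refine Lp.ext ((ae_restrict_iff' measurableSet_Ioo).2 ?_)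
  filter_upwards [key] with x hx hmem
  exact sub_eq_zero.1 (hx hmem)

/-- The Sobolev space of spinors on an edge: square integrable functions on `(0, ℓ)` which have a
square integrable weak first derivative. -/
def edgeSobolev (ℓ : ℝ) : Submodule ℂ (EdgeL2 ℓ) where
  carrier := {f | ∃ g, IsWeakDeriv f g}
  add_mem' := fun ⟨g₁, h₁⟩ ⟨g₂, h₂⟩ => ⟨g₁ + g₂, h₁.add h₂⟩
  zero_mem' := ⟨0, isWeakDeriv_zero⟩
  smul_mem' := fun a _ ⟨g, h⟩ => ⟨a • g, h.smul a⟩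

/-- The weak derivative `d/dx`, as a linear map on the Sobolev space of an edge. -/
def weakDeriv (ℓ : ℝ) : edgeSobolev ℓ →ₗ[ℂ] EdgeL2 ℓ where
  toFun f := f.2.choose
  map_add' f₁ f₂ :=
    (f₁ + f₂).2.choose_spec.unique (f₁.2.choose_spec.add f₂.2.choose_spec)
  map_smul' a f := (a • f).2.choose_spec.unique (f.2.choose_spec.smul a)

theorem weakDeriv_spec {ℓ : ℝ} (f : edgeSobolev ℓ) : IsWeakDeriv (f : EdgeL2 ℓ) (weakDeriv ℓ f) :=
  f.2.choose_spec

/-! ### The Dirac operator -/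

/-- The Dirac matrix `α`. -/
def diracAlpha : Matrix (Fin 4) (Fin 4) ℂ :=
  !![0, 0, 0, -I;
     0, 0, I, 0;
     0, -I, 0, 0;
     I, 0, 0, 0]

/-- The Dirac matrix `β`. -/
def diracBeta : Matrix (Fin 4) (Fin 4) ℂ :=
  !![1, 0, 0, 0;
     0, 1, 0, 0;
     0, 0, -1, 0;
     0, 0, 0, -1]

/-- Pointwise multiplication by a constant `4 × 4` matrix on the spinors on an edge. -/
def matMul (ℓ : ℝ) (M : Matrix (Fin 4) (Fin 4) ℂ) : EdgeL2 ℓ →L[ℂ] EdgeL2 ℓ :=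
  (Matrix.toEuclideanCLM (n := Fin 4) (𝕜 := ℂ) M).compLpL 2 (volume.restrict (Set.Ioo 0 ℓ))

/-- The differential expression `-i ħ c α d/dx + m c² β` on the Sobolev space of an edge. -/
def edgeDirac (hbar c m ℓ : ℝ) : edgeSobolev ℓ →ₗ[ℂ] EdgeL2 ℓ :=
  (-(I * hbar * c)) • ((matMul ℓ diracAlpha).toLinearMap ∘ₗ weakDeriv ℓ) +
    ((m : ℂ) * c ^ 2) • ((matMul ℓ diracBeta).toLinearMap ∘ₗ (edgeSobolev ℓ).subtype)

section Graph

variable {V : Type*} {N : ℕ} (G : MetricGraph V N)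

/-- The Sobolev space of spinors on the graph: each edge component lies in the Sobolev space of
its edge. No condition is imposed at the vertices. -/
def graphSobolev : Submodule ℂ (GraphL2 G) where
  carrier := {ψ | ∀ e, ψ e ∈ edgeSobolev (G.length e)}
  add_mem' := fun h₁ h₂ e => (edgeSobolev (G.length e)).add_mem (h₁ e) (h₂ e)
  zero_mem' := fun e => (edgeSobolev (G.length e)).zero_mem
  smul_mem' := fun a _ h e => (edgeSobolev (G.length e)).smul_mem a (h e)

/-- The Dirac operator `𝒟` on the whole Sobolev space of the graph, acting edge by edge. -/
def diracMax (hbar c m : ℝ) : GraphL2 G →ₗ.[ℂ] GraphL2 G where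
  domain := graphSobolev G
  toFun :=
    { toFun := fun ψ =>
        WithLp.toLp 2 fun e => edgeDirac hbar c m (G.length e) ⟨(ψ : GraphL2 G) e, ψ.2 e⟩
      map_add' := fun ψ₁ ψ₂ => by
        ext1 e
        exact (edgeDirac hbar c m (G.length e)).map_add ⟨(ψ₁ : GraphL2 G) e, ψ₁.2 e⟩
          ⟨(ψ₂ : GraphL2 G) e, ψ₂.2 e⟩
      map_smul' := fun a ψ => by
        ext1 e
        exact (edgeDirac hbar c m (G.length e)).map_smul a ⟨(ψ : GraphL2 G) e, ψ.2 e⟩ }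

variable {G}

/-- `F` is a representative of the spinor `ψ` on the graph which is continuous on each closed edge
`[0, Lₑ]`. The boundary values of `ψ` at the vertices are those of `F`; such an `F` is unique on the
closed edges, and it exists for every `ψ` in the Sobolev space. -/
def IsContRep (ψ : GraphL2 G) (F : Fin N → ℝ → Spinor) : Prop :=
  ∀ e, ContinuousOn (F e) (Set.Icc 0 (G.length e)) ∧
    ψ e =ᵐ[volume.restrict (Set.Ioo 0 (G.length e))] F e

theorem IsContRep.add {ψ₁ ψ₂ : GraphL2 G} {F₁ F₂ : Fin N → ℝ → Spinor} (h₁ : IsContRep ψ₁ F₁)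
    (h₂ : IsContRep ψ₂ F₂) : IsContRep (ψ₁ + ψ₂) (F₁ + F₂) := fun e =>
  ⟨(h₁ e).1.add (h₂ e).1, (Lp.coeFn_add (ψ₁ e) (ψ₂ e)).trans ((h₁ e).2.add (h₂ e).2)⟩

theorem IsContRep.smul {ψ : GraphL2 G} {F : Fin N → ℝ → Spinor} (a : ℂ) (h : IsContRep ψ F) :
    IsContRep (a • ψ) (a • F) := fun e =>
  ⟨(h e).1.const_smul a, (Lp.coeFn_smul a (ψ e)).trans ((h e).2.const_smul a)⟩

theorem isContRep_zero : IsContRep (0 : GraphL2 G) 0 := fun e =>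
  ⟨continuousOn_const, Lp.coeFn_zero Spinor 2 (volume.restrict (Set.Ioo 0 (G.length e)))⟩

variable (G)

/-- Index set of the boundary vectors, of size `4 N`: the end of the edge (`0` for `x = 0`, `1` for
`x = Lₑ`), the edge, and one of two components. -/
abbrev TraceIndex (N : ℕ) := Fin 2 × Fin N × Fin 2

/-- The boundary vector `f₊`: the first and second components `f₁, f₂` at both ends of each edge. -/
def tracePlus (F : Fin N → ℝ → Spinor) : TraceIndex N → ℂ := fun p =>
  ![![F p.2.1 0 0, F p.2.1 0 1],
    ![F p.2.1 (G.length p.2.1) 0, F p.2.1 (G.length p.2.1) 1]] p.1 p.2.2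

/-- The boundary vector `f₋`: the components `-f₄, f₃` at `x = 0` and `f₄, -f₃` at `x = Lₑ`, for
each edge. -/
def traceMinus (F : Fin N → ℝ → Spinor) : TraceIndex N → ℂ := fun p =>
  ![![-F p.2.1 0 3, F p.2.1 0 2],
    ![F p.2.1 (G.length p.2.1) 3, -F p.2.1 (G.length p.2.1) 2]] p.1 p.2.2

theorem tracePlus_add (F₁ F₂ : Fin N → ℝ → Spinor) :
    tracePlus G (F₁ + F₂) = tracePlus G F₁ + tracePlus G F₂ := by
  funext ⟨s, e, j⟩
  fin_cases s <;> fin_cases j <;> simp [tracePlus]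

theorem tracePlus_smul (a : ℂ) (F : Fin N → ℝ → Spinor) :
    tracePlus G (a • F) = a • tracePlus G F := by
  funext ⟨s, e, j⟩
  fin_cases s <;> fin_cases j <;> simp [tracePlus]

theorem traceMinus_add (F₁ F₂ : Fin N → ℝ → Spinor) :
    traceMinus G (F₁ + F₂) = traceMinus G F₁ + traceMinus G F₂ := by
  funext ⟨s, e, j⟩
  fin_cases s <;> fin_cases j <;> simp [traceMinus, add_comm]

theorem traceMinus_smul (a : ℂ) (F : Fin N → ℝ → Spinor) :
    traceMinus G (a • F) = a • traceMinus G F := by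
  funext ⟨s, e, j⟩
  fin_cases s <;> fin_cases j <;> simp [traceMinus]

/-- The spinors on the graph that satisfy the matching conditions `A f₊ + B f₋ = 0`. -/
def matchingSpace {M : Type*} (A B : Matrix M (TraceIndex N) ℂ) : Submodule ℂ (GraphL2 G) where
  carrier := {ψ | ∃ F, IsContRep ψ F ∧ A *ᵥ tracePlus G F + B *ᵥ traceMinus G F = 0}
  add_mem' := by
    rintro ψ₁ ψ₂ ⟨F₁, h₁, e₁⟩ ⟨F₂, h₂, e₂⟩
    refine ⟨F₁ + F₂, h₁.add h₂, ?_⟩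
    rw [tracePlus_add, traceMinus_add, Matrix.mulVec_add, Matrix.mulVec_add, add_add_add_comm,
      e₁, e₂, add_zero]
  zero_mem' := by
    refine ⟨0, isContRep_zero, ?_⟩
    have h₁ := tracePlus_smul G 0 0
    have h₂ := traceMinus_smul G 0 0
    rw [zero_smul, zero_smul] at h₁ h₂
    rw [h₁, h₂, Matrix.mulVec_zero, Matrix.mulVec_zero, add_zero]
  smul_mem' := by
    rintro a ψ ⟨F, h, e⟩
    refine ⟨a • F, h.smul a, ?_⟩
    rw [tracePlus_smul, traceMinus_smul, Matrix.mulVec_smul, Matrix.mulVec_smul, ← smul_add, e,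
      smul_zero]

/-- The spinors on the graph that vanish at the vertices. -/
def vanishingSpace : Submodule ℂ (GraphL2 G) where
  carrier := {ψ | ∃ F, IsContRep ψ F ∧ ∀ e, F e 0 = 0 ∧ F e (G.length e) = 0}
  add_mem' := by
    rintro ψ₁ ψ₂ ⟨F₁, h₁, e₁⟩ ⟨F₂, h₂, e₂⟩
    exact ⟨F₁ + F₂, h₁.add h₂, fun e => by simp [e₁ e, e₂ e]⟩
  zero_mem' := ⟨0, isContRep_zero, fun e => by simp⟩
  smul_mem' := by
    rintro a ψ ⟨F, h, e⟩
    exact ⟨a • F, h.smul a, fun i => by simp [e i]⟩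

/-- The minimal operator `𝒟⁰`: the Dirac operator on the Sobolev functions vanishing at the
vertices. -/
def diracMin (hbar c m : ℝ) : GraphL2 G →ₗ.[ℂ] GraphL2 G :=
  (diracMax G hbar c m).domRestrict (vanishingSpace G)

/-- The Dirac operator on the Sobolev functions satisfying `A f₊ + B f₋ = 0`. -/
def diracOp (hbar c m : ℝ) {M : Type*} (A B : Matrix M (TraceIndex N) ℂ) :
    GraphL2 G →ₗ.[ℂ] GraphL2 G :=
  (diracMax G hbar c m).domRestrict (matchingSpace G A B)

/-- A self-adjoint realization of the Dirac operator on the graph: a self-adjoint operator that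
extends `𝒟⁰` and acts as `𝒟` on a subspace of the Sobolev space of the graph. -/
def IsSelfAdjointRealization (hbar c m : ℝ) (T : GraphL2 G →ₗ.[ℂ] GraphL2 G) : Prop :=
  diracMin G hbar c m ≤ T ∧ T ≤ diracMax G hbar c m ∧ IsSelfAdjoint T

end Graph

end QuantumGraph

end

/-! The argument turns self-adjointness into finite-dimensional linear algebra on boundary values.

A Sobolev spinor on an edge is the primitive of its weak derivative up to a constant (du
Bois-Reymond), so it has an absolutely continuous representative and can be integrated by parts. In
Green's formula the mass term cancels. The boundary term that remains is, up to the factor `hbar *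
c`, the standard symplectic form `⟨p, q'⟩ - ⟨q, p'⟩` of the boundary data `p = f₊`, `q = f₋`
(`inner_diracMax_sub`); the signs in `f₋` are chosen for this.

Let `T` lie between the minimal and the maximal operator. Its domain contains the test functions, so
it is dense, and pairing with test functions shows that the adjoint is again a restriction of the
maximal operator (`adjoint_le_diracMax`). Hence the domain of the adjoint consists of the Sobolev
spinors whose boundary data are symplectically orthogonal to those of the domain of `T`. Every pair
`(p, q)` occurs as boundary data (`exists_trace_eq`), so the operator given by `A f₊ + B f₋ = 0` is
self-adjoint exactly when the kernel of `(A, B)` equals its own symplectic complement.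

That complement is the range of `(A, B)ᴴ` rotated by `(p, q) ↦ (q, -p)`. It lies in the kernel iff
`A Bᴴ = B Aᴴ`, and comparing dimensions yields the rank condition (`ker_fromCols_lagrangian_iff`).
-/

section AbsolutelyContinuous

/-! ### Absolutely continuous vector-valued functions -/

open Set Filter

variable {E : Type*} [NormedAddCommGroup E] {a b : ℝ}

/-- Increments of the integral of `f` are dominated by those of the integral of `‖f‖`, which reduces
the claim to the real-valued case. -/
theorem AbsolutelyContinuousOnInterval.intervalIntegral_of_intervalIntegrable [NormedSpace ℝ E]
    {f : ℝ → E} (hf : IntervalIntegrable f volume a b) :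
    AbsolutelyContinuousOnInterval (fun x => ∫ t in a..x, f t) a b := by
  have h := hf.norm.absolutelyContinuousOnInterval_intervalIntegral (c := a) (by simp)
  unfold AbsolutelyContinuousOnInterval at h ⊢
  refine squeeze_zero' (Eventually.of_forall fun _ => Finset.sum_nonneg fun _ _ => dist_nonneg) ?_ h
  rw [eventually_inf_principal]
  refine Eventually.of_forall fun E hE => Finset.sum_le_sum fun i hi => ?_
  have hx : (E.2 i).1 ∈ uIcc a b := (hE.1 i hi).1
  have hy : (E.2 i).2 ∈ uIcc a b := (hE.1 i hi).2
  have hi1 : IntervalIntegrable f volume a (E.2 i).1 :=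
    hf.mono_set (uIcc_subset_uIcc left_mem_uIcc hx)
  have hi2 : IntervalIntegrable f volume a (E.2 i).2 :=
    hf.mono_set (uIcc_subset_uIcc left_mem_uIcc hy)
  rw [dist_eq_norm, dist_eq_norm, intervalIntegral.integral_interval_sub_left hi1 hi2,
    intervalIntegral.integral_interval_sub_left hi1.norm hi2.norm]
  exact intervalIntegral.norm_integral_le_abs_integral_norm

theorem AbsolutelyContinuousOnInterval.inner {𝕜 : Type*} [RCLike 𝕜] [InnerProductSpace 𝕜 E]
    {f g : ℝ → E} (hf : AbsolutelyContinuousOnInterval f a b)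
    (hg : AbsolutelyContinuousOnInterval g a b) :
    AbsolutelyContinuousOnInterval (fun x => inner 𝕜 (f x) (g x)) a b := by
  obtain ⟨C, hC⟩ := hf.exists_bound
  obtain ⟨D, hD⟩ := hg.exists_bound
  unfold AbsolutelyContinuousOnInterval at hf hg ⊢
  refine squeeze_zero' (Eventually.of_forall fun _ => Finset.sum_nonneg fun _ _ => dist_nonneg) ?_
    (by simpa using (hg.const_mul C).add (hf.const_mul D))
  rw [eventually_inf_principal]
  refine Eventually.of_forall fun I hI => ?_
  simp only [Finset.mul_sum, ← Finset.sum_add_distrib]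
  refine Finset.sum_le_sum fun i hi => ?_
  set x := (I.2 i).1
  set y := (I.2 i).2
  have hx : x ∈ uIcc a b := (hI.1 i hi).1
  have hy : y ∈ uIcc a b := (hI.1 i hi).2
  -- The product-rule splitting: the first term is at most `C` times the increment of `g`, the
  -- second at most `D` times that of `f`.
  have e : Inner.inner 𝕜 (f x) (g x) - Inner.inner 𝕜 (f y) (g y) =
      Inner.inner 𝕜 (f x) (g x - g y) + Inner.inner 𝕜 (f x - f y) (g y) := by
    rw [inner_sub_right, inner_sub_left]; ring
  rw [dist_eq_norm, dist_eq_norm, dist_eq_norm, e]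
  refine (norm_add_le _ _).trans (add_le_add ?_ ?_)
  · exact (norm_inner_le_norm _ _).trans (by gcongr; exact hC _ hx)
  · refine (norm_inner_le_norm _ _).trans ?_
    rw [mul_comm]
    gcongr
    exact hD _ hy

/-- The difference of `f` and the primitive of `f'` is absolutely continuous with derivative zero
almost everywhere, hence constant. -/
theorem AbsolutelyContinuousOnInterval.integral_eq_sub_of_ae_hasDerivAt [NormedSpace ℝ E]
    [CompleteSpace E] {f f' : ℝ → E} (hf : AbsolutelyContinuousOnInterval f a b)
    (hf' : IntervalIntegrable f' volume a b)
    (h : ∀ᵐ x, x ∈ uIcc a b → HasDerivAt f (f' x) x) :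
    ∫ x in a..b, f' x = f b - f a := by
  have hF := intervalIntegral_of_intervalIntegrable hf'
  obtain ⟨C, hC⟩ := (hf.sub hF).const_of_ae_hasDerivAt_zero (by
    filter_upwards [h, hf'.ae_hasDerivAt_integral] with x h₁ h₂ hx
    simpa using (h₁ hx).sub (h₂ hx a left_mem_uIcc))
  have h₁ := hC a left_mem_uIcc
  have h₂ := hC b right_mem_uIcc
  simp only [Pi.sub_apply, intervalIntegral.integral_same, sub_zero] at h₁ h₂
  rw [h₁, ← h₂]
  abel

end AbsolutelyContinuous

/-! ### Sobolev functions on an edge as primitives -/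

noncomputable section

namespace QuantumGraph

open Set Filter

theorem edgeL2_intervalIntegrable {ℓ : ℝ} (hℓ : 0 < ℓ) (g : EdgeL2 ℓ) :
    IntervalIntegrable g volume 0 ℓ := by
  rw [intervalIntegrable_iff_integrableOn_Ioo_of_le hℓ.le]
  exact (Lp.memLp g).integrable (by norm_num)

/-- The primitive of `g` on `[0, ℓ]` with value `a` at `0`. -/
def primitive {ℓ : ℝ} (g : EdgeL2 ℓ) (a : Spinor) (x : ℝ) : Spinor := a + ∫ t in 0..x, g t

@[simp]
theorem primitive_zero {ℓ : ℝ} (g : EdgeL2 ℓ) (a : Spinor) : primitive g a 0 = a := by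
  simp [primitive]

theorem primitive_absolutelyContinuous {ℓ : ℝ} (hℓ : 0 < ℓ) (g : EdgeL2 ℓ) (a : Spinor) :
    AbsolutelyContinuousOnInterval (primitive g a) 0 ℓ := by
  refine AbsolutelyContinuousOnInterval.add (f := fun _ => a) ?_
    (AbsolutelyContinuousOnInterval.intervalIntegral_of_intervalIntegrable
      (edgeL2_intervalIntegrable hℓ g))
  exact (contDiffOn_const (c := a)).absolutelyContinuousOnInterval

theorem primitive_continuousOn {ℓ : ℝ} (hℓ : 0 < ℓ) (g : EdgeL2 ℓ) (a : Spinor) :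
    ContinuousOn (primitive g a) (Icc 0 ℓ) := by
  simpa [uIcc_of_le hℓ.le] using (primitive_absolutelyContinuous hℓ g a).continuousOn

theorem primitive_ae_hasDerivAt {ℓ : ℝ} (hℓ : 0 < ℓ) (g : EdgeL2 ℓ) (a : Spinor) :
    ∀ᵐ x, x ∈ uIcc 0 ℓ → HasDerivAt (primitive g a) (g x) x := by
  filter_upwards [(edgeL2_intervalIntegrable hℓ g).ae_hasDerivAt_integral] with x h hx
  exact (h hx 0 left_mem_uIcc).const_add a

theorem memLp_of_continuousOn {ℓ : ℝ} {F : ℝ → Spinor} (hF : ContinuousOn F (Icc 0 ℓ)) :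
    MemLp F 2 (volume.restrict (Ioo 0 ℓ)) := by
  obtain ⟨C, hC⟩ := isCompact_Icc.exists_bound_of_continuousOn hF
  refine MemLp.of_bound ((hF.mono Ioo_subset_Icc_self).aestronglyMeasurable measurableSet_Ioo) C ?_
  filter_upwards [ae_restrict_mem measurableSet_Ioo] with x hx
  exact hC x (Ioo_subset_Icc_self hx)

theorem eqOn_of_ae_eq {ℓ : ℝ} (hℓ : 0 < ℓ) {F₁ F₂ : ℝ → Spinor}
    (h₁ : ContinuousOn F₁ (Icc 0 ℓ)) (h₂ : ContinuousOn F₂ (Icc 0 ℓ))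
    (h : F₁ =ᵐ[volume.restrict (Ioo 0 ℓ)] F₂) : EqOn F₁ F₂ (Icc 0 ℓ) := by
  refine Measure.eqOn_Icc_of_ae_eq volume hℓ.ne ?_ h₁ h₂
  rwa [restrict_Ioo_eq_restrict_Icc] at h

/-- Integration by parts of a primitive against a test function. -/
theorem integral_deriv_smul_primitive {ℓ : ℝ} (hℓ : 0 < ℓ) (g : EdgeL2 ℓ) (a : Spinor)
    {φ : ℝ → ℝ} (hφ : ContDiff ℝ ∞ φ) (hs : tsupport φ ⊆ Ioo 0 ℓ) :
    ∫ x in Ioo 0 ℓ, deriv φ x • primitive g a x = -∫ x in Ioo 0 ℓ, φ x • g x := by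
  have h0 : φ 0 = 0 := image_eq_zero_of_notMem_tsupport fun h => (hs h).1.ne rfl
  have h1 : φ ℓ = 0 := image_eq_zero_of_notMem_tsupport fun h => (hs h).2.ne rfl
  have hφ' : Continuous (deriv φ) := hφ.continuous_deriv (by simp)
  have hP := primitive_absolutelyContinuous hℓ g a
  have ac := (hφ.of_le (by simp)).contDiffOn.absolutelyContinuousOnInterval.smul hP
  have i₁ : IntervalIntegrable (fun x => deriv φ x • primitive g a x) volume 0 ℓ :=
    (hφ'.continuousOn.smul hP.continuousOn).intervalIntegrable
  have i₂ : IntervalIntegrable (fun x => φ x • g x) volume 0 ℓ :=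
    (edgeL2_intervalIntegrable hℓ g).continuousOn_smul hφ.continuous.continuousOn
  have key := ac.integral_eq_sub_of_ae_hasDerivAt (i₁.add i₂) (by
    filter_upwards [primitive_ae_hasDerivAt hℓ g a] with x hx hmem
    have := ((hφ.differentiable (by simp)).differentiableAt (x := x)).hasDerivAt.smul (hx hmem)
    simpa [add_comm] using this)
  rw [intervalIntegral.integral_add i₁ i₂] at key
  simp only [Pi.smul_apply', h0, h1, zero_smul, sub_zero] at key
  rw [intervalIntegral.integral_of_le hℓ.le, intervalIntegral.integral_of_le hℓ.le,
    integral_Ioc_eq_integral_Ioo, integral_Ioc_eq_integral_Ioo] at key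
  exact eq_neg_of_add_eq_zero_left key

theorem isWeakDeriv_of_ae_eq_primitive {ℓ : ℝ} (hℓ : 0 < ℓ) {f g : EdgeL2 ℓ} {a : Spinor}
    (h : f =ᵐ[volume.restrict (Ioo 0 ℓ)] primitive g a) : IsWeakDeriv f g := by
  intro φ hφ hc hs
  rw [← integral_deriv_smul_primitive hℓ g a hφ hs]
  refine integral_congr_ae ?_
  filter_upwards [h] with x hx
  rw [hx]

/-- The antiderivative of a test function of mean zero is a test function. -/
theorem exists_antideriv {ℓ : ℝ} (hℓ : 0 < ℓ) {ψ : ℝ → ℝ} (hψ : ContDiff ℝ ∞ ψ)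
    (hc : HasCompactSupport ψ) (hs : tsupport ψ ⊆ Ioo 0 ℓ) (h0 : ∫ x in Ioo 0 ℓ, ψ x = 0) :
    ∃ φ : ℝ → ℝ, ContDiff ℝ ∞ φ ∧ HasCompactSupport φ ∧ tsupport φ ⊆ Ioo 0 ℓ ∧ deriv φ = ψ := by
  have hd : ∀ x, HasDerivAt (fun x => ∫ t in 0..x, ψ t) (ψ x) x := fun x =>
    intervalIntegral.integral_hasDerivAt_right (hψ.continuous.intervalIntegrable _ _)
      (hψ.continuous.stronglyMeasurableAtFilter _ _) hψ.continuous.continuousAt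
  have hderiv : deriv (fun x => ∫ t in 0..x, ψ t) = ψ := funext fun x => (hd x).deriv
  -- The support is compact in the open interval, so it keeps a positive distance from both ends.
  -- The midpoint serves when the support is empty.
  obtain ⟨a, b, hsub, ha0, hbl⟩ : ∃ a b, tsupport ψ ⊆ Icc a b ∧ 0 < a ∧ b < ℓ := by
    rcases (tsupport ψ).eq_empty_or_nonempty with he | hne
    · exact ⟨ℓ / 2, ℓ / 2, by simp [he], by linarith, by linarith⟩
    · have hK : IsCompact (tsupport ψ) := hc
      have h1 := hs (hK.sInf_mem hne)
      have h2 := hs (hK.sSup_mem hne)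
      exact ⟨sInf (tsupport ψ), sSup (tsupport ψ),
        fun x hx => ⟨csInf_le hK.bddBelow hx, le_csSup hK.bddAbove hx⟩, h1.1, h2.2⟩
  have hz : ∀ x, x ∉ Icc a b → ψ x = 0 := fun x hx =>
    image_eq_zero_of_notMem_tsupport fun h => hx (hsub h)
  -- Left of `a` nothing has been integrated yet; right of `b` the integral is the full one, which
  -- is zero by hypothesis.
  have hφz : ∀ x, x ∉ Icc a b → ∫ t in 0..x, ψ t = 0 := by
    intro x hx
    rcases lt_or_ge x a with hxa | hxa
    · refine intervalIntegral.integral_zero_ae (Eventually.of_forall fun t ht => hz t fun h => ?_)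
      rw [mem_uIoc] at ht
      rcases ht with ht | ht <;> linarith [h.1, ht.1, ht.2]
    · have hxb : b < x := lt_of_not_ge fun h => hx ⟨hxa, h⟩
      have e1 : ∫ t in 0..ℓ, ψ t = 0 := by
        rw [intervalIntegral.integral_of_le hℓ.le, integral_Ioc_eq_integral_Ioo, h0]
      have e2 : ∫ t in ℓ..x, ψ t = 0 := by
        refine intervalIntegral.integral_zero_ae (Eventually.of_forall fun t ht => hz t fun h => ?_)
        rw [mem_uIoc] at ht
        rcases ht with ht | ht <;> linarith [h.2, ht.1, ht.2]
      rw [← intervalIntegral.integral_add_adjacent_intervals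
        (hψ.continuous.intervalIntegrable 0 ℓ) (hψ.continuous.intervalIntegrable ℓ x), e1, e2,
        add_zero]
  have hts : tsupport (fun x => ∫ t in 0..x, ψ t) ⊆ Icc a b :=
    closure_minimal (fun x hx => by_contra fun h => hx (hφz x h)) isClosed_Icc
  refine ⟨fun x => ∫ t in 0..x, ψ t, ?_, ?_, ?_, hderiv⟩
  · rw [contDiff_infty_iff_deriv]
    exact ⟨fun x => (hd x).differentiableAt, by rw [hderiv]; exact hψ⟩
  · exact HasCompactSupport.of_support_subset_isCompact isCompact_Icc
      (subset_closure.trans hts)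
  · exact hts.trans fun x hx => ⟨ha0.trans_le hx.1, hx.2.trans_lt hbl⟩

theorem exists_testFunction_integral_one {ℓ : ℝ} (hℓ : 0 < ℓ) :
    ∃ χ : ℝ → ℝ, ContDiff ℝ ∞ χ ∧ HasCompactSupport χ ∧ tsupport χ ⊆ Ioo 0 ℓ ∧
      ∫ x in Ioo 0 ℓ, χ x = 1 := by
  let χ : ContDiffBump (ℓ / 2) := ⟨ℓ / 8, ℓ / 4, by linarith, by linarith⟩
  have hs : tsupport (χ.normed volume) ⊆ Ioo 0 ℓ := by
    rw [χ.tsupport_normed_eq, Real.closedBall_eq_Icc]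
    intro x hx
    have h1 : ℓ / 2 - ℓ / 4 ≤ x := hx.1
    have h2 : x ≤ ℓ / 2 + ℓ / 4 := hx.2
    constructor <;> linarith
  refine ⟨χ.normed volume, χ.contDiff_normed, χ.hasCompactSupport_normed, hs, ?_⟩
  rw [setIntegral_eq_integral_of_forall_compl_eq_zero
    fun x hx => image_eq_zero_of_notMem_tsupport fun h => hx (hs h)]
  exact χ.integral_normed

/-- The lemma of du Bois-Reymond. -/
theorem ae_eq_const_of_integral_deriv_smul {ℓ : ℝ} (hℓ : 0 < ℓ) {h : ℝ → Spinor}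
    (hi : IntegrableOn h (Ioo 0 ℓ))
    (hw : ∀ φ : ℝ → ℝ, ContDiff ℝ ∞ φ → HasCompactSupport φ → tsupport φ ⊆ Ioo 0 ℓ →
      ∫ x in Ioo 0 ℓ, deriv φ x • h x = 0) :
    ∃ a, h =ᵐ[volume.restrict (Ioo 0 ℓ)] fun _ => a := by
  obtain ⟨χ, hχ, hχc, hχs, hχ1⟩ := exists_testFunction_integral_one hℓ
  have hint : ∀ ψ : ℝ → ℝ, Continuous ψ → HasCompactSupport ψ → IntegrableOn (fun x => ψ x • h x)
      (Ioo 0 ℓ) := fun ψ hψ hc => by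
    obtain ⟨C, hC⟩ := hψ.bounded_above_of_compact_support hc
    exact Integrable.bdd_smul hi C hψ.aestronglyMeasurable (Eventually.of_forall hC)
  have hintψ : ∀ ψ : ℝ → ℝ, Continuous ψ → HasCompactSupport ψ → IntegrableOn ψ (Ioo 0 ℓ) :=
    fun ψ hψ hc => (hψ.integrable_of_hasCompactSupport hc).integrableOn
  -- If `h` is constant, its value has to be its average against `χ`, since `χ` has integral one.
  set a := ∫ x in Ioo 0 ℓ, χ x • h x with ha
  have key : ∀ᵐ x, x ∈ Ioo 0 ℓ → (fun x => h x - a) x = 0 := by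
    refine isOpen_Ioo.ae_eq_zero_of_integral_contDiff_smul_eq_zero
      ((hi.sub (integrableOn_const (by simp))).locallyIntegrableOn) ?_
    intro ψ hψ hc hs
    have e : ∫ x, ψ x • (h x - a) = ∫ x in Ioo 0 ℓ, ψ x • (h x - a) := by
      refine (setIntegral_eq_integral_of_forall_compl_eq_zero ?_).symm
      intro x hx
      rw [image_eq_zero_of_notMem_tsupport (fun h => hx (hs h)), zero_smul]
    set s := ∫ x in Ioo 0 ℓ, ψ x with hs'
    -- Subtracting `s * χ` makes the mean zero, so the difference is the derivative of a test
    -- function and `hw` applies to it.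
    obtain ⟨φ, hφ, hφc, hφs, hd⟩ := exists_antideriv hℓ (ψ := fun x => ψ x - s * χ x)
      (hψ.sub (contDiff_const.mul hχ)) (hc.sub hχc.mul_left)
      ((tsupport_sub _ _).trans (union_subset hs
        ((tsupport_mul_subset_right).trans hχs)))
      (by rw [integral_sub (hintψ ψ hψ.continuous hc) ((hintψ χ hχ.continuous hχc).const_mul s),
            integral_const_mul, hχ1, ← hs']; ring)
    have h0 := hw φ hφ hφc hφs
    rw [hd] at h0
    simp only [sub_smul, mul_smul] at h0
    have hsχ : IntegrableOn (fun x => s • χ x • h x) (Ioo 0 ℓ) :=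
      (hint χ hχ.continuous hχc).smul s
    rw [show (∫ x in Ioo 0 ℓ, (ψ x • h x - s • χ x • h x)) = _ from
      integral_sub (hint ψ hψ.continuous hc) hsχ, integral_smul, ← ha] at h0
    rw [e]
    simp only [smul_sub]
    rw [integral_sub (hint ψ hψ.continuous hc) ((hintψ ψ hψ.continuous hc).smul_const a),
      integral_smul_const, ← hs', h0]
  refine ⟨a, (ae_restrict_iff' measurableSet_Ioo).2 ?_⟩
  filter_upwards [key] with x hx hmem
  exact sub_eq_zero.1 (hx hmem)

/-- Both `f` and `primitive g 0` have weak derivative `g`, so du Bois-Reymond applies to their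
difference. -/
theorem IsWeakDeriv.exists_ae_eq_primitive {ℓ : ℝ} (hℓ : 0 < ℓ) {f g : EdgeL2 ℓ}
    (h : IsWeakDeriv f g) : ∃ a, f =ᵐ[volume.restrict (Ioo 0 ℓ)] primitive g a := by
  have hf : IntegrableOn f (Ioo 0 ℓ) := (Lp.memLp f).integrable (by norm_num)
  have hP : IntegrableOn (primitive g 0) (Ioo 0 ℓ) :=
    (memLp_of_continuousOn (primitive_continuousOn hℓ g 0)).integrable (by norm_num)
  obtain ⟨a, ha⟩ := ae_eq_const_of_integral_deriv_smul hℓ (hf.sub hP) (by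
    intro φ hφ hc hs
    have hφ' : Continuous (deriv φ) := hφ.continuous_deriv (by simp)
    obtain ⟨C, hC⟩ := hφ'.bounded_above_of_compact_support hc.deriv
    have hi : IntegrableOn (fun x => deriv φ x • primitive g 0 x) (Ioo 0 ℓ) :=
      Integrable.bdd_smul hP C hφ'.aestronglyMeasurable (Eventually.of_forall hC)
    simp only [Pi.sub_apply, smul_sub]
    rw [integral_sub (integrable_deriv_smul f hφ hc) hi, h φ hφ hc hs,
      integral_deriv_smul_primitive hℓ g 0 hφ hs, sub_self])
  refine ⟨a, ?_⟩
  filter_upwards [ha] with x hx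
  rw [Pi.sub_apply, sub_eq_iff_eq_add] at hx
  rw [hx]
  simp [primitive]

/-- Identifies any continuous representative on the closed edge, endpoints included, so that the
boundary values in Green's formula are those of an absolutely continuous function. -/
theorem IsWeakDeriv.eqOn_primitive {ℓ : ℝ} (hℓ : 0 < ℓ) {f g : EdgeL2 ℓ}
    (h : IsWeakDeriv f g) {F : ℝ → Spinor} (hF : ContinuousOn F (Icc 0 ℓ))
    (hfF : f =ᵐ[volume.restrict (Ioo 0 ℓ)] F) : EqOn F (primitive g (F 0)) (Icc 0 ℓ) := by
  obtain ⟨a, ha⟩ := h.exists_ae_eq_primitive hℓ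
  have he := eqOn_of_ae_eq hℓ hF (primitive_continuousOn hℓ g a) (hfF.symm.trans ha)
  have h0 : F 0 = a := by simpa using he (left_mem_Icc.2 hℓ.le)
  rwa [h0]

/-- Green's formula on an edge. -/
theorem IsWeakDeriv.inner_add_inner {ℓ : ℝ} (hℓ : 0 < ℓ) {f₁ g₁ f₂ g₂ : EdgeL2 ℓ}
    (h₁ : IsWeakDeriv f₁ g₁) (h₂ : IsWeakDeriv f₂ g₂) {F₁ F₂ : ℝ → Spinor}
    (c₁ : ContinuousOn F₁ (Icc 0 ℓ)) (e₁ : f₁ =ᵐ[volume.restrict (Ioo 0 ℓ)] F₁)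
    (c₂ : ContinuousOn F₂ (Icc 0 ℓ)) (e₂ : f₂ =ᵐ[volume.restrict (Ioo 0 ℓ)] F₂) :
    inner ℂ g₁ f₂ + inner ℂ f₁ g₂ = inner ℂ (F₁ ℓ) (F₂ ℓ) - inner ℂ (F₁ 0) (F₂ 0) := by
  have p₁ := h₁.eqOn_primitive hℓ c₁ e₁
  have p₂ := h₂.eqOn_primitive hℓ c₂ e₂
  have ac := (primitive_absolutelyContinuous hℓ g₁ (F₁ 0)).inner (𝕜 := ℂ)
    (primitive_absolutelyContinuous hℓ g₂ (F₂ 0))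
  have q₁ : f₁ =ᵐ[volume.restrict (Ioo 0 ℓ)] primitive g₁ (F₁ 0) := by
    filter_upwards [e₁, ae_restrict_mem measurableSet_Ioo] with x hx hmem
    rw [hx, p₁ (Ioo_subset_Icc_self hmem)]
  have q₂ : f₂ =ᵐ[volume.restrict (Ioo 0 ℓ)] primitive g₂ (F₂ 0) := by
    filter_upwards [e₂, ae_restrict_mem measurableSet_Ioo] with x hx hmem
    rw [hx, p₂ (Ioo_subset_Icc_self hmem)]
  have i₁ := L2.integrable_inner (𝕜 := ℂ) g₁ f₂
  have i₂ := L2.integrable_inner (𝕜 := ℂ) f₁ g₂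
  have hcongr : (fun x => inner ℂ (g₁ x) (f₂ x) + inner ℂ (f₁ x) (g₂ x))
      =ᵐ[volume.restrict (Ioo 0 ℓ)] fun x => inner ℂ (primitive g₁ (F₁ 0) x) (g₂ x) +
        inner ℂ (g₁ x) (primitive g₂ (F₂ 0) x) := by
    filter_upwards [q₁, q₂] with x hx hy
    rw [hx, hy, add_comm]
  have ii := (i₁.add i₂).congr hcongr
  have key := ac.integral_eq_sub_of_ae_hasDerivAt
    ((intervalIntegrable_iff_integrableOn_Ioo_of_le hℓ.le).2 ii) (by
    filter_upwards [primitive_ae_hasDerivAt hℓ g₁ (F₁ 0), primitive_ae_hasDerivAt hℓ g₂ (F₂ 0)]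
      with x hx hy hmem
    exact (hx hmem).inner ℂ (hy hmem))
  rw [L2.inner_def, L2.inner_def, ← integral_add i₁ i₂, integral_congr_ae hcongr,
    p₁ (right_mem_Icc.2 hℓ.le), p₂ (right_mem_Icc.2 hℓ.le)]
  rw [intervalIntegral.integral_of_le hℓ.le, integral_Ioc_eq_integral_Ioo] at key
  rw [key, primitive_zero, primitive_zero]

end QuantumGraph

end

noncomputable section

namespace QuantumGraph

open Set Filter

/-! ### Continuous functions as elements of the edge space -/

/-- The class in `L²(0, ℓ)` of a continuous function on `[0, ℓ]`. -/
def contLp {ℓ : ℝ} (F : ℝ → Spinor) (hF : ContinuousOn F (Icc 0 ℓ)) : EdgeL2 ℓ :=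
  (memLp_of_continuousOn hF).toLp F

theorem coeFn_contLp {ℓ : ℝ} (F : ℝ → Spinor) (hF : ContinuousOn F (Icc 0 ℓ)) :
    contLp F hF =ᵐ[volume.restrict (Ioo 0 ℓ)] F :=
  (memLp_of_continuousOn hF).coeFn_toLp

theorem isWeakDeriv_contLp {ℓ : ℝ} (hℓ : 0 < ℓ) {F F' : ℝ → Spinor}
    (hd : ∀ x, HasDerivAt F (F' x) x) (hF : ContinuousOn F (Icc 0 ℓ))
    (hF' : ContinuousOn F' (Icc 0 ℓ)) :
    IsWeakDeriv (contLp F hF) (contLp F' hF') := by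
  refine isWeakDeriv_of_ae_eq_primitive hℓ (a := F 0) ((coeFn_contLp F hF).trans ?_)
  filter_upwards [ae_restrict_mem measurableSet_Ioo] with x hx
  have hae := (ae_restrict_iff' measurableSet_Ioo).1 (coeFn_contLp F' hF')
  -- The class agrees with `F'` only almost everywhere on the open edge, which suffices because `(0,
  -- x]` lies inside it.
  have e : ∫ t in 0..x, contLp F' hF' t = ∫ t in 0..x, F' t := by
    refine intervalIntegral.integral_congr_ae ?_
    filter_upwards [hae] with t ht hmem
    rw [uIoc_of_le hx.1.le] at hmem
    exact ht ⟨hmem.1, hmem.2.trans_lt hx.2⟩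
  rw [primitive, e, intervalIntegral.integral_eq_sub_of_hasDerivAt (fun t _ => hd t)]
  · abel
  · refine (hF'.mono ?_).intervalIntegrable
    rw [uIcc_of_le hx.1.le]
    exact Icc_subset_Icc_right hx.2.le

theorem continuousOn_smul_const {ℓ : ℝ} {φ : ℝ → ℝ} (hφ : Continuous φ) (v : Spinor) :
    ContinuousOn (fun x => φ x • v) (Icc 0 ℓ) :=
  (hφ.smul continuous_const).continuousOn

theorem inner_contLp_smul {ℓ : ℝ} {φ : ℝ → ℝ} (hφ : Continuous φ) (hc : HasCompactSupport φ)
    (v : Spinor) (f : EdgeL2 ℓ) :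
    inner ℂ (contLp (fun x => φ x • v) (continuousOn_smul_const hφ v)) f =
      inner ℂ v (∫ x in Ioo 0 ℓ, φ x • f x) := by
  rw [L2.inner_def, ← integral_inner (integrable_smul f hφ hc)]
  refine integral_congr_ae ?_
  filter_upwards [coeFn_contLp (ℓ := ℓ) (fun x => φ x • v) (continuousOn_smul_const hφ v)]
    with x hx
  rw [hx, RCLike.real_smul_eq_coe_smul (K := ℂ), RCLike.real_smul_eq_coe_smul (K := ℂ),
    inner_smul_left, inner_smul_right, RCLike.conj_ofReal]

/-- Vector-valued test functions `φ • v` detect every component of the integrals. In this form the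
definition of an adjoint can be fed in directly. -/
theorem isWeakDeriv_of_inner {ℓ : ℝ} {f g : EdgeL2 ℓ}
    (h : ∀ (φ : ℝ → ℝ) (hφ : ContDiff ℝ ∞ φ), HasCompactSupport φ → tsupport φ ⊆ Ioo 0 ℓ →
      ∀ v : Spinor,
        inner ℂ (contLp (fun x => deriv φ x • v)
          (continuousOn_smul_const (hφ.continuous_deriv (by simp)) v)) f =
        -inner ℂ (contLp (fun x => φ x • v) (continuousOn_smul_const hφ.continuous v)) g) :
    IsWeakDeriv f g := by
  intro φ hφ hc hs
  refine ext_inner_left ℂ fun v => ?_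
  rw [inner_neg_right, ← inner_contLp_smul hφ.continuous hc,
    ← inner_contLp_smul (hφ.continuous_deriv (by simp)) hc.deriv]
  exact h φ hφ hc hs v

/-- The hypothesis makes `f` a weak derivative of `0`, so uniqueness of weak derivatives gives the
claim. -/
theorem eq_zero_of_inner_contLp {ℓ : ℝ} {f : EdgeL2 ℓ}
    (h : ∀ (φ : ℝ → ℝ) (hφ : ContDiff ℝ ∞ φ), HasCompactSupport φ → tsupport φ ⊆ Ioo 0 ℓ →
      ∀ v : Spinor,
        inner ℂ (contLp (fun x => φ x • v) (continuousOn_smul_const hφ.continuous v)) f = 0) :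
    f = 0 := by
  refine IsWeakDeriv.unique (f := 0) (isWeakDeriv_of_inner fun φ hφ hc hs v => ?_)
    isWeakDeriv_zero
  rw [inner_zero_right, h φ hφ hc hs v, neg_zero]

/-! ### Constant matrices -/

/-- The action of a `4 × 4` matrix on spinors. -/
abbrev spinMul (M : Matrix (Fin 4) (Fin 4) ℂ) : Spinor →L[ℂ] Spinor :=
  Matrix.toEuclideanCLM (n := Fin 4) (𝕜 := ℂ) M

theorem inner_spinMul_left {M : Matrix (Fin 4) (Fin 4) ℂ} (hM : M.IsHermitian) (v w : Spinor) :
    inner ℂ (spinMul M v) w = inner ℂ v (spinMul M w) := by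
  have : star (spinMul M) = spinMul M := by
    rw [spinMul, ← map_star, Matrix.star_eq_conjTranspose, hM.eq]
  conv_lhs => rw [← this]
  rw [ContinuousLinearMap.star_eq_adjoint, ContinuousLinearMap.adjoint_inner_left]

theorem diracAlpha_isHermitian : diracAlpha.IsHermitian := by
  ext i j
  fin_cases i <;> fin_cases j <;> simp [diracAlpha]

theorem diracBeta_isHermitian : diracBeta.IsHermitian := by
  ext i j
  fin_cases i <;> fin_cases j <;> simp [diracBeta]

theorem diracAlpha_mul_self : diracAlpha * diracAlpha = 1 := by
  ext i j
  fin_cases i <;> fin_cases j <;> simp [diracAlpha, Matrix.mul_apply, Fin.sum_univ_four]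

theorem spinMul_diracAlpha_self (v : Spinor) :
    spinMul diracAlpha (spinMul diracAlpha v) = v := by
  rw [← mul_apply_eq_comp, spinMul, ← map_mul, diracAlpha_mul_self, map_one]
  rfl

theorem coeFn_matMul {ℓ : ℝ} (M : Matrix (Fin 4) (Fin 4) ℂ) (f : EdgeL2 ℓ) :
    matMul ℓ M f =ᵐ[volume.restrict (Ioo 0 ℓ)] fun x => spinMul M (f x) :=
  ContinuousLinearMap.coeFn_compLpL _ _

theorem inner_matMul_left {ℓ : ℝ} {M : Matrix (Fin 4) (Fin 4) ℂ} (hM : M.IsHermitian)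
    (f g : EdgeL2 ℓ) : inner ℂ (matMul ℓ M f) g = inner ℂ f (matMul ℓ M g) := by
  rw [L2.inner_def, L2.inner_def]
  refine integral_congr_ae ?_
  filter_upwards [coeFn_matMul M f, coeFn_matMul M g] with x hx hy
  rw [hx, hy, inner_spinMul_left hM]

theorem matMul_diracAlpha_self {ℓ : ℝ} (f : EdgeL2 ℓ) :
    matMul ℓ diracAlpha (matMul ℓ diracAlpha f) = f := by
  refine Lp.ext ?_
  filter_upwards [coeFn_matMul diracAlpha (matMul ℓ diracAlpha f), coeFn_matMul diracAlpha f]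
    with x hx hy
  rw [hx, hy, spinMul_diracAlpha_self]

theorem matMul_contLp_smul {ℓ : ℝ} (M : Matrix (Fin 4) (Fin 4) ℂ) {φ : ℝ → ℝ} (hφ : Continuous φ)
    (v : Spinor) :
    matMul ℓ M (contLp (fun x => φ x • v) (continuousOn_smul_const hφ v)) =
      contLp (fun x => φ x • spinMul M v) (continuousOn_smul_const hφ _) := by
  refine Lp.ext ?_
  filter_upwards [coeFn_matMul M (contLp (ℓ := ℓ) (fun x => φ x • v) (continuousOn_smul_const hφ v)),
    coeFn_contLp (ℓ := ℓ) (fun x => φ x • v) (continuousOn_smul_const hφ v),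
    coeFn_contLp (ℓ := ℓ) (fun x => φ x • spinMul M v) (continuousOn_smul_const hφ _)]
    with x h₁ h₂ h₃
  rw [h₁, h₂, h₃, ContinuousLinearMap.map_smul_of_tower]

theorem IsWeakDeriv.matMul {ℓ : ℝ} {f g : EdgeL2 ℓ} (h : IsWeakDeriv f g)
    (M : Matrix (Fin 4) (Fin 4) ℂ) : IsWeakDeriv (matMul ℓ M f) (matMul ℓ M g) := by
  have key : ∀ (φ : ℝ → ℝ), Continuous φ → HasCompactSupport φ → ∀ f : EdgeL2 ℓ,
      ∫ x in Ioo 0 ℓ, φ x • QuantumGraph.matMul ℓ M f x =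
        spinMul M (∫ x in Ioo 0 ℓ, φ x • f x) := fun φ hφ hc f => by
    rw [← ContinuousLinearMap.integral_comp_comm _ (integrable_smul f hφ hc)]
    refine integral_congr_ae ?_
    filter_upwards [coeFn_matMul M f] with x hx
    rw [hx, ContinuousLinearMap.map_smul_of_tower]
  intro φ hφ hc hs
  rw [key _ (hφ.continuous_deriv (by simp)) hc.deriv, key _ hφ.continuous hc, h φ hφ hc hs, map_neg]

/-! ### The Dirac operator on an edge -/

theorem edgeDirac_apply (hbar c m : ℝ) {ℓ : ℝ} {f g : EdgeL2 ℓ} (h : IsWeakDeriv f g)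
    (hf : f ∈ edgeSobolev ℓ) :
    edgeDirac hbar c m ℓ ⟨f, hf⟩ =
      (-(I * hbar * c)) • matMul ℓ diracAlpha g + ((m : ℂ) * c ^ 2) • matMul ℓ diracBeta f := by
  have : weakDeriv ℓ ⟨f, hf⟩ = g := (weakDeriv_spec ⟨f, hf⟩).unique h
  simp [edgeDirac, this]

/-- Green's formula for the Dirac operator on an edge. -/
theorem inner_edgeDirac_sub (hbar c m : ℝ) {ℓ : ℝ} (hℓ : 0 < ℓ) (f₁ f₂ : edgeSobolev ℓ)
    {F₁ F₂ : ℝ → Spinor}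
    (c₁ : ContinuousOn F₁ (Icc 0 ℓ)) (e₁ : (f₁ : EdgeL2 ℓ) =ᵐ[volume.restrict (Ioo 0 ℓ)] F₁)
    (c₂ : ContinuousOn F₂ (Icc 0 ℓ)) (e₂ : (f₂ : EdgeL2 ℓ) =ᵐ[volume.restrict (Ioo 0 ℓ)] F₂) :
    inner ℂ (edgeDirac hbar c m ℓ f₁) (f₂ : EdgeL2 ℓ) -
        inner ℂ (f₁ : EdgeL2 ℓ) (edgeDirac hbar c m ℓ f₂) =
      I * hbar * c * (inner ℂ (spinMul diracAlpha (F₁ ℓ)) (F₂ ℓ) -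
        inner ℂ (spinMul diracAlpha (F₁ 0)) (F₂ 0)) := by
  obtain ⟨f₁, hf₁⟩ := f₁
  obtain ⟨f₂, hf₂⟩ := f₂
  obtain ⟨g₁, h₁⟩ := id hf₁
  obtain ⟨g₂, h₂⟩ := id hf₂
  have green := (h₁.matMul diracAlpha).inner_add_inner hℓ h₂
    (F₁ := fun x => spinMul diracAlpha (F₁ x))
    ((spinMul diracAlpha).continuous.comp_continuousOn c₁)
    ((coeFn_matMul diracAlpha f₁).trans (by filter_upwards [e₁] with x hx; rw [hx])) c₂ e₂
  -- The two mass terms coincide because `β` is Hermitian and `m c²` is real, so they cancel in the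
  -- difference.
  rw [← green, edgeDirac_apply hbar c m h₁, edgeDirac_apply hbar c m h₂, inner_add_left,
    inner_add_right, inner_smul_left, inner_smul_left, inner_smul_right, inner_smul_right,
    inner_matMul_left diracBeta_isHermitian, inner_matMul_left diracAlpha_isHermitian f₁ g₂]
  simp only [map_neg, map_mul, map_pow, conj_I, conj_ofReal]
  ring

theorem contLp_smul_mem_edgeSobolev {ℓ : ℝ} (hℓ : 0 < ℓ) {φ : ℝ → ℝ} (hφ : ContDiff ℝ ∞ φ)
    (v : Spinor) :
    contLp (fun x => φ x • v) (continuousOn_smul_const hφ.continuous v) ∈ edgeSobolev ℓ :=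
  ⟨_, isWeakDeriv_contLp hℓ
    (fun x => ((hφ.differentiable (by simp)).differentiableAt (x := x)).hasDerivAt.smul_const v) _
    (continuousOn_smul_const (hφ.continuous_deriv (by simp)) v)⟩

/-- An element of the edge space on which the formal adjoint of the Dirac operator acts
distributionally by an element of the edge space lies in the Sobolev space. -/
theorem isWeakDeriv_of_inner_edgeDirac {hbar c : ℝ} (m : ℝ) (hhbar : hbar ≠ 0) (hc : c ≠ 0) {ℓ : ℝ}
    (hℓ : 0 < ℓ) {w u : EdgeL2 ℓ}
    (h : ∀ (φ : ℝ → ℝ) (hφ : ContDiff ℝ ∞ φ), HasCompactSupport φ → tsupport φ ⊆ Ioo 0 ℓ →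
      ∀ v : Spinor,
        inner ℂ u (contLp (fun x => φ x • v) (continuousOn_smul_const hφ.continuous v)) =
        inner ℂ w (edgeDirac hbar c m ℓ ⟨_, contLp_smul_mem_edgeSobolev hℓ hφ v⟩)) :
    IsWeakDeriv w ((I / (hbar * c)) •
      matMul ℓ diracAlpha (u - ((m : ℂ) * c ^ 2) • matMul ℓ diracBeta w)) := by
  refine isWeakDeriv_of_inner fun φ hφ hcs hs v => ?_
  have hφ' : Continuous (deriv φ) := hφ.continuous_deriv (by simp)
  have hd : IsWeakDeriv
      (contLp (fun x => φ x • spinMul diracAlpha v) (continuousOn_smul_const hφ.continuous _))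
      (contLp (ℓ := ℓ) (fun x => deriv φ x • spinMul diracAlpha v)
        (continuousOn_smul_const hφ' _)) :=
    isWeakDeriv_contLp hℓ (fun x =>
      ((hφ.differentiable (by simp)).differentiableAt (x := x)).hasDerivAt.smul_const _) _ _
  -- Testing against `α v` removes `α` from the derivative term, since `α² = 1`. Conjugation moves
  -- the test function to the left slot.
  have key := congrArg (starRingEnd ℂ) (h φ hφ hcs hs (spinMul diracAlpha v))
  rw [edgeDirac_apply hbar c m hd, ← matMul_contLp_smul diracAlpha hφ.continuous,
    ← matMul_contLp_smul diracAlpha hφ', matMul_diracAlpha_self, inner_conj_symm, inner_conj_symm,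
    inner_add_left, inner_smul_left, inner_smul_left,
    inner_matMul_left diracBeta_isHermitian, inner_matMul_left diracAlpha_isHermitian,
    inner_matMul_left diracAlpha_isHermitian] at key
  simp only [map_neg, map_mul, map_pow, conj_I, conj_ofReal] at key
  rw [inner_smul_right, map_sub, inner_sub_right, map_smul, inner_smul_right, key]
  have h1 : (hbar : ℂ) ≠ 0 := by exact_mod_cast hhbar
  have h2 : (c : ℂ) ≠ 0 := by exact_mod_cast hc
  field_simp
  ring_nf
  simp

theorem edgeDirac_eq_of_inner {hbar c m : ℝ} (hhbar : hbar ≠ 0) (hc : c ≠ 0) {ℓ : ℝ}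
    {w u : EdgeL2 ℓ} (h : IsWeakDeriv w ((I / (hbar * c)) •
      matMul ℓ diracAlpha (u - ((m : ℂ) * c ^ 2) • matMul ℓ diracBeta w)))
    (hw : w ∈ edgeSobolev ℓ) : edgeDirac hbar c m ℓ ⟨w, hw⟩ = u := by
  have h1 : (hbar : ℂ) ≠ 0 := by exact_mod_cast hhbar
  have h2 : (c : ℂ) ≠ 0 := by exact_mod_cast hc
  have e : -(I * hbar * c) * (I / (hbar * c)) = 1 := by
    field_simp
    simp
  rw [edgeDirac_apply hbar c m h, map_smul, matMul_diracAlpha_self, smul_smul, e, one_smul,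
    sub_add_cancel]

end QuantumGraph

end

/-! ### Linear algebra: kernels that equal their symplectic complement -/

namespace Matrix

variable {μ ι κ : Type*}

/-- The orthogonal complement of `ker M` is the range of the adjoint of `M`. -/
theorem exists_eq_conjTranspose_mulVec [Fintype μ] [Fintype κ] (M : Matrix μ κ ℂ) {w : κ → ℂ}
    (h : ∀ k, M *ᵥ k = 0 → star w ⬝ᵥ k = 0) : ∃ z, w = Mᴴ *ᵥ z := by
  classical
  have hw : WithLp.toLp 2 w ∈ (LinearMap.ker (Matrix.toEuclideanLin M))ᗮ := by
    rw [Submodule.mem_orthogonal']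
    intro k hk
    rw [EuclideanSpace.inner_eq_star_dotProduct, dotProduct_comm]
    refine h _ ?_
    simpa [Matrix.toLpLin_apply] using hk
  rw [LinearMap.orthogonal_ker, ← Matrix.toEuclideanLin_conjTranspose_eq_adjoint] at hw
  obtain ⟨z, hz⟩ := hw
  exact ⟨WithLp.ofLp z, by simpa [Matrix.toLpLin_apply] using (congrArg WithLp.ofLp hz).symm⟩

/-- The complex structure `(p, q) ↦ (q, -p)`. -/
def symplecticRotation (ι : Type*) : (ι ⊕ ι → ℂ) ≃ₗ[ℂ] (ι ⊕ ι → ℂ) where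
  toFun w := Sum.elim (fun i => w (Sum.inr i)) fun i => -w (Sum.inl i)
  invFun w := Sum.elim (fun i => -w (Sum.inr i)) fun i => w (Sum.inl i)
  map_add' v w := by ext (i | i) <;> simp [add_comm]
  map_smul' a w := by ext (i | i) <;> simp
  left_inv w := by ext (i | i) <;> simp
  right_inv w := by ext (i | i) <;> simp

theorem symplecticRotation_fromCols [Fintype μ] (A B : Matrix μ ι ℂ) (z : μ → ℂ) :
    symplecticRotation ι ((fromCols A B)ᴴ *ᵥ z) = Sum.elim (Bᴴ *ᵥ z) (-(Aᴴ *ᵥ z)) := by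
  rw [conjTranspose_fromCols_eq_fromRows_conjTranspose, fromRows_mulVec]
  rfl

open scoped ComplexOrder in
/-- The kernel of `(A, B)` is its own symplectic complement iff `(A, B)` has full rank and
`A Bᴴ` is Hermitian. -/
theorem ker_fromCols_lagrangian_iff [Fintype μ] [Fintype ι] (A B : Matrix μ ι ℂ)
    (hcard : Fintype.card μ = Fintype.card ι) :
    (∀ p q, A *ᵥ p + B *ᵥ q = 0 ↔
      ∀ p' q', A *ᵥ p' + B *ᵥ q' = 0 → star p ⬝ᵥ q' = star q ⬝ᵥ p') ↔
    (fromCols A B).rank = Fintype.card μ ∧ A * Bᴴ = B * Aᴴ := by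
  set K := LinearMap.ker (fromCols A B).mulVecLin with hK
  set R := (LinearMap.range (fromCols A B)ᴴ.mulVecLin).map
    (symplecticRotation ι : (ι ⊕ ι → ℂ) →ₗ[ℂ] (ι ⊕ ι → ℂ)) with hR
  have memK : ∀ p q, Sum.elim p q ∈ K ↔ A *ᵥ p + B *ᵥ q = 0 := fun p q => by
    rw [hK, LinearMap.mem_ker, mulVecLin_apply, fromCols_mulVec_sumElim]
  -- `R` is the symplectic complement of `K`: `(p, q)` is symplectically orthogonal to `K` iff `(-q,
  -- p)`, its preimage under the rotation, is orthogonal to `K` in the usual sense.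
  have memR : ∀ p q, Sum.elim p q ∈ R ↔
      ∀ p' q', A *ᵥ p' + B *ᵥ q' = 0 → star p ⬝ᵥ q' = star q ⬝ᵥ p' := fun p q => by
    constructor
    · rintro ⟨_, ⟨z, rfl⟩, hz⟩ p' q' h
      rw [mulVecLin_apply, LinearEquiv.coe_coe, symplecticRotation_fromCols] at hz
      obtain rfl : Bᴴ *ᵥ z = p := funext fun i => congrFun hz (Sum.inl i)
      obtain rfl : -(Aᴴ *ᵥ z) = q := funext fun i => congrFun hz (Sum.inr i)
      rw [star_neg, neg_dotProduct, eq_neg_iff_add_eq_zero, star_mulVec, star_mulVec,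
        conjTranspose_conjTranspose, conjTranspose_conjTranspose, ← dotProduct_mulVec,
        ← dotProduct_mulVec, ← dotProduct_add, add_comm, h, dotProduct_zero]
    · intro h
      obtain ⟨z, hz⟩ := exists_eq_conjTranspose_mulVec (fromCols A B) (w := Sum.elim (-q) p) (by
        intro k hk
        obtain ⟨p', q', rfl⟩ : ∃ p' q', k = Sum.elim p' q' :=
          ⟨k ∘ Sum.inl, k ∘ Sum.inr, (Sum.elim_comp_inl_inr k).symm⟩
        rw [fromCols_mulVec_sumElim] at hk
        have := h p' q' hk
        simp only [dotProduct, Fintype.sum_sum_type, Pi.star_apply, Sum.elim_inl, Sum.elim_inr,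
          Pi.neg_apply, star_neg, neg_mul, Finset.sum_neg_distrib] at this ⊢
        rw [this, neg_add_cancel])
      refine ⟨_, ⟨z, rfl⟩, ?_⟩
      rw [mulVecLin_apply, ← hz]
      ext (i | i) <;> simp [symplecticRotation]
  have ext_iff : (∀ p q, Sum.elim p q ∈ K ↔ Sum.elim p q ∈ R) ↔ K = R := by
    refine ⟨fun h => SetLike.ext fun k => ?_, fun h p q => by rw [h]⟩
    rw [← Sum.elim_comp_inl_inr k]
    exact h _ _
  have finK : (fromCols A B).rank + Module.finrank ℂ K = Fintype.card ι + Fintype.card ι := by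
    have := LinearMap.finrank_range_add_finrank_ker (fromCols A B).mulVecLin
    rwa [Module.finrank_fintype_fun_eq_card, Fintype.card_sum] at this
  have finR : Module.finrank ℂ R = (fromCols A B).rank := by
    rw [hR, LinearEquiv.finrank_map_eq, ← rank_conjTranspose]
    rfl
  -- Applying `(A, B)` to the rotated vector `(Bᴴ z, -Aᴴ z)` gives `(A Bᴴ - B Aᴴ) z`.
  have hRK : R ≤ K ↔ A * Bᴴ = B * Aᴴ := by
    have hz : ∀ z, symplecticRotation ι ((fromCols A B)ᴴ *ᵥ z) ∈ K ↔
        (A * Bᴴ) *ᵥ z = (B * Aᴴ) *ᵥ z := fun z => by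
      rw [symplecticRotation_fromCols, memK, mulVec_neg, mulVec_mulVec, mulVec_mulVec,
        ← sub_eq_add_neg, sub_eq_zero]
    constructor
    · intro h
      classical
      exact Matrix.ext_of_mulVec_single fun i => (hz _).1 (h ⟨_, ⟨_, rfl⟩, rfl⟩)
    · rintro h _ ⟨_, ⟨z, rfl⟩, rfl⟩
      exact (hz z).2 (by rw [h])
  have step : (∀ p q, A *ᵥ p + B *ᵥ q = 0 ↔
      ∀ p' q', A *ᵥ p' + B *ᵥ q' = 0 → star p ⬝ᵥ q' = star q ⬝ᵥ p') ↔ K = R := by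
    rw [← ext_iff]
    exact forall₂_congr fun p q => by rw [memK, memR]
  rw [step, ← hRK, hcard]
  -- With `n = card ι` and `r` the rank, `dim K = 2n - r` and `dim R = r`. Equality of the spaces
  -- forces `r = n`; conversely `r = n` makes the dimensions equal, so the inclusion `R ≤ K` is an
  -- equality.
  constructor
  · intro h
    refine ⟨?_, h.ge⟩
    rw [h, finR] at finK
    omega
  · rintro ⟨h₁, h₂⟩
    exact (Submodule.eq_of_le_of_finrank_eq h₂ (by omega)).symm

end Matrix

noncomputable section

namespace QuantumGraph

open Set Filter

variable {V : Type*} {N : ℕ} (G : MetricGraph V N)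

/-! ### Traces -/

variable {G} in
theorem exists_isContRep {ψ : GraphL2 G} (hψ : ψ ∈ graphSobolev G) : ∃ F, IsContRep ψ F := by
  have h : ∀ e, ∃ F, ContinuousOn F (Icc 0 (G.length e)) ∧
      ψ e =ᵐ[volume.restrict (Ioo 0 (G.length e))] F := fun e => by
    obtain ⟨g, hg⟩ := hψ e
    obtain ⟨a, ha⟩ := hg.exists_ae_eq_primitive (G.length_pos e)
    exact ⟨_, primitive_continuousOn (G.length_pos e) g a, ha⟩
  choose F hF using h
  exact ⟨F, hF⟩

variable {G} in
theorem IsContRep.eqOn {ψ : GraphL2 G} {F₁ F₂ : Fin N → ℝ → Spinor} (h₁ : IsContRep ψ F₁)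
    (h₂ : IsContRep ψ F₂) (e : Fin N) : EqOn (F₁ e) (F₂ e) (Icc 0 (G.length e)) :=
  eqOn_of_ae_eq (G.length_pos e) (h₁ e).1 (h₂ e).1 ((h₁ e).2.symm.trans (h₂ e).2)

variable {G} in
theorem IsContRep.trace_eq {ψ : GraphL2 G} {F₁ F₂ : Fin N → ℝ → Spinor} (h₁ : IsContRep ψ F₁)
    (h₂ : IsContRep ψ F₂) :
    tracePlus G F₁ = tracePlus G F₂ ∧ traceMinus G F₁ = traceMinus G F₂ := by
  have e0 : ∀ e, F₁ e 0 = F₂ e 0 := fun e => h₁.eqOn h₂ e (left_mem_Icc.2 (G.length_pos e).le)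
  have e1 : ∀ e, F₁ e (G.length e) = F₂ e (G.length e) :=
    fun e => h₁.eqOn h₂ e (right_mem_Icc.2 (G.length_pos e).le)
  constructor <;> funext p <;> simp only [tracePlus, traceMinus, e0, e1]

/-- The values at the two ends of an edge can be prescribed independently, and affine interpolation
between them is smooth. -/
theorem exists_trace_eq (p q : TraceIndex N → ℂ) :
    ∃ ψ ∈ graphSobolev G, ∃ F, IsContRep ψ F ∧ tracePlus G F = p ∧ traceMinus G F = q := by
  -- `a` and `b` invert the definitions of the boundary vectors at `x = 0` and `x = Lₑ`, including
  -- the swap of the last two components and the signs.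
  let a : Fin N → Spinor := fun e => !₂[p (0, e, 0), p (0, e, 1), q (0, e, 1), -q (0, e, 0)]
  let b : Fin N → Spinor := fun e => !₂[p (1, e, 0), p (1, e, 1), -q (1, e, 1), q (1, e, 0)]
  let F : Fin N → ℝ → Spinor := fun e x => a e + x • ((G.length e)⁻¹ • (b e - a e))
  have hd : ∀ e x, HasDerivAt (F e) ((G.length e)⁻¹ • (b e - a e)) x := fun e x => by
    have h := ((hasDerivAt_id x).smul_const ((G.length e)⁻¹ • (b e - a e))).const_add (a e)
    rwa [one_smul] at h
  have hF : ∀ e, ContinuousOn (F e) (Icc 0 (G.length e)) :=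
    fun e x _ => (hd e x).continuousAt.continuousWithinAt
  have F0 : ∀ e, F e 0 = a e := fun e => by simp [F]
  have F1 : ∀ e, F e (G.length e) = b e := fun e => by
    simp only [F]
    rw [smul_inv_smul₀ (G.length_pos e).ne']
    abel
  refine ⟨WithLp.toLp 2 fun e => contLp (F e) (hF e),
    fun e => ⟨_, isWeakDeriv_contLp (G.length_pos e) (hd e) (hF e) continuousOn_const⟩, F,
    fun e => ⟨hF e, coeFn_contLp _ (hF e)⟩, ?_, ?_⟩
  · funext ⟨s, e, j⟩
    fin_cases s <;> fin_cases j <;> simp [tracePlus, F0, F1, a, b]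
  · funext ⟨s, e, j⟩
    fin_cases s <;> fin_cases j <;> simp [traceMinus, F0, F1, a, b]

theorem spinMul_diracAlpha (v : Spinor) :
    spinMul diracAlpha v = !₂[-I * v 3, I * v 2, -I * v 1, I * v 0] := by
  ext i
  rw [spinMul, Matrix.ofLp_toEuclideanCLM]
  fin_cases i <;> simp [Matrix.mulVec, dotProduct, Fin.sum_univ_four, diracAlpha]

/-- Since `α` pairs the components `1, 4` and `2, 3`, the boundary form only couples `f₊` with `f₋`.
The opposite signs of `f₋` at the two ends absorb the minus sign of the lower endpoint. -/
theorem sum_inner_diracAlpha (F₁ F₂ : Fin N → ℝ → Spinor) :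
    ∑ e, I * (inner ℂ (spinMul diracAlpha (F₁ e (G.length e))) (F₂ e (G.length e)) -
        inner ℂ (spinMul diracAlpha (F₁ e 0)) (F₂ e 0)) =
      star (tracePlus G F₁) ⬝ᵥ traceMinus G F₂ - star (traceMinus G F₁) ⬝ᵥ tracePlus G F₂ := by
  have h : ∀ v w : Spinor, I * inner ℂ (spinMul diracAlpha v) w =
      star (v 0) * w 3 - star (v 1) * w 2 + star (v 2) * w 1 - star (v 3) * w 0 := fun v w => by
    rw [spinMul_diracAlpha, PiLp.inner_apply, Fin.sum_univ_four]
    simp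
    ring_nf
    simp
    ring
  simp only [mul_sub, h, dotProduct, Fintype.sum_prod_type, Fin.sum_univ_two, Pi.star_apply,
    tracePlus, traceMinus, ← Finset.sum_add_distrib, ← Finset.sum_sub_distrib]
  refine Finset.sum_congr rfl fun e _ => ?_
  simp
  ring

/-- Green's formula for the Dirac operator on a graph. -/
theorem inner_diracMax_sub (hbar c m : ℝ) (ψ₁ ψ₂ : (diracMax G hbar c m).domain)
    {F₁ F₂ : Fin N → ℝ → Spinor} (h₁ : IsContRep (ψ₁ : GraphL2 G) F₁)
    (h₂ : IsContRep (ψ₂ : GraphL2 G) F₂) :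
    inner ℂ (diracMax G hbar c m ψ₁) (ψ₂ : GraphL2 G) -
        inner ℂ (ψ₁ : GraphL2 G) (diracMax G hbar c m ψ₂) =
      hbar * c * (star (tracePlus G F₁) ⬝ᵥ traceMinus G F₂ -
        star (traceMinus G F₁) ⬝ᵥ tracePlus G F₂) := by
  rw [← sum_inner_diracAlpha, PiLp.inner_apply, PiLp.inner_apply, ← Finset.sum_sub_distrib,
    Finset.mul_sum]
  refine Finset.sum_congr rfl fun e _ => ?_
  have := inner_edgeDirac_sub hbar c m (G.length_pos e) ⟨(ψ₁ : GraphL2 G) e, ψ₁.2 e⟩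
    ⟨(ψ₂ : GraphL2 G) e, ψ₂.2 e⟩ (h₁ e).1 (h₁ e).2 (h₂ e).1 (h₂ e).2
  refine this.trans ?_
  ring

/-! ### Spinors supported on one edge -/

theorem single_mem_graphSobolev (e : Fin N) {f : EdgeL2 (G.length e)}
    (hf : f ∈ edgeSobolev (G.length e)) : (PiLp.single 2 e f : GraphL2 G) ∈ graphSobolev G := by
  intro e'
  by_cases h : e' = e
  · subst h
    rwa [PiLp.single_eq_same]
  · rw [PiLp.single_eq_of_ne 2 h]
    exact Submodule.zero_mem _

theorem inner_single_right (w : GraphL2 G) (e : Fin N) (f : EdgeL2 (G.length e)) :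
    inner ℂ w (PiLp.single 2 e f) = inner ℂ (w e) f := by
  rw [PiLp.inner_apply, Finset.sum_eq_single e, PiLp.single_eq_same]
  · intro e' _ h
    rw [PiLp.single_eq_of_ne 2 h, inner_zero_right]
  · simp

theorem diracMax_single (hbar c m : ℝ) (e : Fin N) {f : EdgeL2 (G.length e)}
    (hf : f ∈ edgeSobolev (G.length e)) :
    diracMax G hbar c m ⟨PiLp.single 2 e f, single_mem_graphSobolev G e hf⟩ =
      PiLp.single 2 e (edgeDirac hbar c m (G.length e) ⟨f, hf⟩) := by
  -- Stated for a variable `f'` so that `f' = 0` can be substituted despite the membership proof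
  -- depending on it.
  have key : ∀ e' (f' : EdgeL2 (G.length e')) (hf' : f' ∈ edgeSobolev (G.length e')), f' = 0 →
      edgeDirac hbar c m (G.length e') ⟨f', hf'⟩ = 0 := by
    rintro e' f' hf' rfl
    exact (edgeDirac hbar c m (G.length e')).map_zero
  ext1 e'
  by_cases h : e' = e
  · subst h
    rw [PiLp.single_eq_same]
    exact congrArg (edgeDirac hbar c m (G.length e')) (Subtype.ext
      (PiLp.single_eq_same (β := fun e => EdgeL2 (G.length e)) 2 e' f))
  · rw [PiLp.single_eq_of_ne 2 h]
    exact key e' _ _ (PiLp.single_eq_of_ne (β := fun e => EdgeL2 (G.length e)) 2 h f)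

theorem single_contLp_mem_vanishingSpace (e : Fin N) {φ : ℝ → ℝ} (hφ : Continuous φ)
    (hs : tsupport φ ⊆ Ioo 0 (G.length e)) (v : Spinor) :
    (PiLp.single 2 e (contLp (fun x => φ x • v) (continuousOn_smul_const hφ v)) : GraphL2 G) ∈
      vanishingSpace G := by
  have h0 : φ 0 = 0 := image_eq_zero_of_notMem_tsupport fun h => (hs h).1.ne rfl
  have h1 : φ (G.length e) = 0 := image_eq_zero_of_notMem_tsupport fun h => (hs h).2.ne rfl
  refine ⟨Pi.single e fun x => φ x • v, fun e' => ?_, fun e' => ?_⟩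
  · by_cases h : e' = e
    · subst h
      rw [PiLp.single_eq_same, Pi.single_eq_same]
      exact ⟨continuousOn_smul_const hφ v, coeFn_contLp _ _⟩
    · rw [PiLp.single_eq_of_ne 2 h, Pi.single_eq_of_ne h]
      exact ⟨continuousOn_const, Lp.coeFn_zero _ _ _⟩
  · by_cases h : e' = e
    · subst h
      simp [h0, h1]
    · simp [Pi.single_eq_of_ne h]

/-! ### Adjoints of realizations -/

variable {G} {hbar c m : ℝ} {T : GraphL2 G →ₗ.[ℂ] GraphL2 G}

theorem single_contLp_mem_domain (hT : diracMin G hbar c m ≤ T) (e : Fin N) {φ : ℝ → ℝ}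
    (hφ : ContDiff ℝ ∞ φ) (hs : tsupport φ ⊆ Ioo 0 (G.length e)) (v : Spinor) :
    (PiLp.single 2 e (contLp (fun x => φ x • v) (continuousOn_smul_const hφ.continuous v)) :
      GraphL2 G) ∈ T.domain :=
  hT.1 ⟨single_contLp_mem_vanishingSpace G e hφ.continuous hs v,
    single_mem_graphSobolev G e (contLp_smul_mem_edgeSobolev (G.length_pos e) hφ v)⟩

/-- A vector orthogonal to the domain is orthogonal on each edge to all test functions, hence zero.
-/
theorem dense_domain (hT : diracMin G hbar c m ≤ T) : Dense (T.domain : Set (GraphL2 G)) := by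
  rw [Submodule.dense_iff_topologicalClosure_eq_top, Submodule.topologicalClosure_eq_top_iff,
    Submodule.eq_bot_iff]
  intro w hw
  rw [Submodule.mem_orthogonal'] at hw
  ext1 e
  refine eq_zero_of_inner_contLp fun φ hφ _ hs v => ?_
  have := hw _ (single_contLp_mem_domain hT e hφ hs v)
  rwa [inner_single_right, inner_eq_zero_symm] at this

/-- The adjoint identity, tested on spinors supported inside a single edge, says that the Dirac
expression holds distributionally there. This yields both the Sobolev regularity and the action of
the adjoint. -/
theorem adjoint_le_diracMax (hhbar : hbar ≠ 0) (hc : c ≠ 0) (hT : diracMin G hbar c m ≤ T)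
    (hT' : T ≤ diracMax G hbar c m) : T.adjoint ≤ diracMax G hbar c m := by
  have key : ∀ (y : T.adjoint.domain) (e : Fin N),
      IsWeakDeriv ((y : GraphL2 G) e) ((I / (hbar * c)) • matMul (G.length e) diracAlpha
        (T.adjoint y e - ((m : ℂ) * c ^ 2) • matMul (G.length e) diracBeta ((y : GraphL2 G) e))) :=
    fun y e => by
      refine isWeakDeriv_of_inner_edgeDirac m hhbar hc (G.length_pos e) fun φ hφ _ hs v => ?_
      have hmem := contLp_smul_mem_edgeSobolev (G.length_pos e) hφ v
      have h := LinearPMap.adjoint_isFormalAdjoint (dense_domain hT) y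
        ⟨_, single_contLp_mem_domain hT e hφ hs v⟩
      rwa [hT'.2 (y := ⟨_, single_mem_graphSobolev G e hmem⟩) rfl, diracMax_single,
        inner_single_right, inner_single_right] at h
  refine ⟨fun y hy e => ⟨_, key ⟨y, hy⟩ e⟩, ?_⟩
  rintro y ⟨z, hz⟩ hyz
  obtain rfl : (y : GraphL2 G) = z := hyz
  ext1 e
  exact (edgeDirac_eq_of_inner hhbar hc (key y e) (hz e)).symm

/-- The adjoint can only act as the maximal operator, so membership means that the boundary term in
Green's formula vanishes against the whole domain of `T`. The factor `hbar * c` is nonzero and drops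
out. -/
theorem mem_adjoint_domain_iff (hhbar : hbar ≠ 0) (hc : c ≠ 0) (hT : diracMin G hbar c m ≤ T)
    (hT' : T ≤ diracMax G hbar c m) {y : GraphL2 G} (hy : y ∈ graphSobolev G)
    {F : Fin N → ℝ → Spinor} (hF : IsContRep y F) :
    y ∈ T.adjoint.domain ↔ ∀ x ∈ T.domain, ∀ F', IsContRep x F' →
      star (tracePlus G F) ⬝ᵥ traceMinus G F' = star (traceMinus G F) ⬝ᵥ tracePlus G F' := by
  have h1 : (hbar : ℂ) ≠ 0 := by exact_mod_cast hhbar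
  have h2 : (c : ℂ) ≠ 0 := by exact_mod_cast hc
  have key : ∀ (x : T.domain) F', IsContRep (x : GraphL2 G) F' →
      (inner ℂ (diracMax G hbar c m ⟨y, hy⟩) (x : GraphL2 G) = inner ℂ y (T x) ↔
      star (tracePlus G F) ⬝ᵥ traceMinus G F' = star (traceMinus G F) ⬝ᵥ tracePlus G F') :=
    fun x F' hF' => by
      have hx : (x : GraphL2 G) ∈ (diracMax G hbar c m).domain := hT'.1 x.2
      have green := inner_diracMax_sub G hbar c m ⟨y, hy⟩ ⟨x, hx⟩ hF hF'
      rw [hT'.2 (x := x) (y := ⟨x, hx⟩) rfl, ← sub_eq_zero, green, mul_eq_zero, sub_eq_zero]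
      simp [h1, h2]
  constructor
  · intro h x hx F' hF'
    refine (key ⟨x, hx⟩ F' hF').1 ?_
    rw [← LinearPMap.adjoint_isFormalAdjoint (dense_domain hT) ⟨y, h⟩ ⟨x, hx⟩,
      (adjoint_le_diracMax hhbar hc hT hT').2 (x := ⟨y, h⟩) (y := ⟨y, hy⟩) rfl]
  · intro h
    refine LinearPMap.mem_adjoint_domain_of_exists _ ⟨diracMax G hbar c m ⟨y, hy⟩, fun x => ?_⟩
    obtain ⟨F', hF'⟩ := exists_isContRep (hT'.1 x.2)
    exact (key x F' hF').2 (h x x.2 F' hF')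

/-! ### Matching conditions -/

variable {M : Type*} {A B : Matrix M (TraceIndex N) ℂ}

theorem diracMin_le_diracOp : diracMin G hbar c m ≤ diracOp G hbar c m A B := by
  refine ⟨?_, ?_⟩
  · rintro ψ ⟨⟨F, hF, h0⟩, hψ⟩
    have hp : tracePlus G F = 0 := by
      funext ⟨s, e, j⟩
      fin_cases s <;> fin_cases j <;> simp [tracePlus, h0]
    have hm : traceMinus G F = 0 := by
      funext ⟨s, e, j⟩
      fin_cases s <;> fin_cases j <;> simp [traceMinus, h0]
    exact ⟨⟨F, hF, by simp [hp, hm]⟩, hψ⟩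
  · intro x y hxy
    have hx : diracMin G hbar c m x = diracMax G hbar c m ⟨x, x.2.2⟩ :=
      LinearPMap.domRestrict_apply rfl
    have hy : diracOp G hbar c m A B y = diracMax G hbar c m ⟨x, x.2.2⟩ :=
      LinearPMap.domRestrict_apply hxy.symm
    rw [hx, hy]

theorem diracOp_le_diracMax : diracOp G hbar c m A B ≤ diracMax G hbar c m :=
  LinearPMap.domRestrict_le

theorem mem_diracOp_domain_iff {y : GraphL2 G} (hy : y ∈ graphSobolev G)
    {F : Fin N → ℝ → Spinor} (hF : IsContRep y F) :
    y ∈ (diracOp G hbar c m A B).domain ↔ A *ᵥ tracePlus G F + B *ᵥ traceMinus G F = 0 := by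
  refine ⟨?_, fun h => ⟨⟨F, hF, h⟩, hy⟩⟩
  rintro ⟨⟨F', hF', h⟩, -⟩
  rwa [(hF.trace_eq hF').1, (hF.trace_eq hF').2]

/-- The operator and its adjoint both restrict the maximal one, so they are equal iff their domains
are. Surjectivity of the trace turns this into an equality of subspaces of boundary data. -/
theorem isSelfAdjointRealization_diracOp_iff (hhbar : hbar ≠ 0) (hc : c ≠ 0) :
    IsSelfAdjointRealization G hbar c m (diracOp G hbar c m A B) ↔
      ∀ p q, A *ᵥ p + B *ᵥ q = 0 ↔
        ∀ p' q', A *ᵥ p' + B *ᵥ q' = 0 → star p ⬝ᵥ q' = star q ⬝ᵥ p' := by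
  have hmin := diracMin_le_diracOp (G := G) (hbar := hbar) (c := c) (m := m) (A := A) (B := B)
  have hmax := diracOp_le_diracMax (G := G) (hbar := hbar) (c := c) (m := m) (A := A) (B := B)
  have hadj : ∀ {y : GraphL2 G} {F : Fin N → ℝ → Spinor}, y ∈ graphSobolev G → IsContRep y F →
      (y ∈ (diracOp G hbar c m A B).adjoint.domain ↔
        ∀ p' q', A *ᵥ p' + B *ᵥ q' = 0 →
          star (tracePlus G F) ⬝ᵥ q' = star (traceMinus G F) ⬝ᵥ p') := fun {y F} hy hF => by
    rw [mem_adjoint_domain_iff hhbar hc hmin hmax hy hF]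
    constructor
    · intro h p' q' hpq
      obtain ⟨x, hx, F', hF', rfl, rfl⟩ := exists_trace_eq G p' q'
      exact h x ((mem_diracOp_domain_iff hx hF').2 hpq) F' hF'
    · intro h x hx F' hF'
      exact h _ _ ((mem_diracOp_domain_iff (hmax.1 hx) hF').1 hx)
  constructor
  · rintro ⟨-, -, hsa⟩ p q
    obtain ⟨y, hy, F, hF, rfl, rfl⟩ := exists_trace_eq G p q
    rw [← hadj hy hF, ← mem_diracOp_domain_iff (hbar := hbar) (c := c) (m := m) hy hF,
      LinearPMap.isSelfAdjoint_def.1 hsa]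
  · intro h
    refine ⟨hmin, hmax, LinearPMap.isSelfAdjoint_def.2 ?_⟩
    have hle := adjoint_le_diracMax hhbar hc hmin hmax
    have hdom : (diracOp G hbar c m A B).adjoint.domain = (diracOp G hbar c m A B).domain := by
      ext y
      -- Boundary values are available only on the Sobolev space; outside it `y` belongs to neither
      -- domain.
      by_cases hy : y ∈ graphSobolev G
      · obtain ⟨F, hF⟩ := exists_isContRep hy
        rw [hadj hy hF, mem_diracOp_domain_iff hy hF, h]
      · exact iff_of_false (fun h' => hy (hle.1 h')) fun h' => hy (hmax.1 h')
    refine LinearPMap.eq_of_le_of_domain_eq ⟨hdom.le, fun x y hxy => ?_⟩ hdom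
    exact (hle.2 (y := ⟨x, hle.1 x.2⟩) rfl).trans (hmax.2 (y := ⟨x, hle.1 x.2⟩) hxy.symm).symm

end QuantumGraph

end

theorem mainTheorem1 {V : Type*} {N : ℕ} (G : QuantumGraph.MetricGraph V N)
    (hbar c m : ℝ) (hhbar : 0 < hbar) (hc : 0 < c)
    (A B : Matrix (Fin (4 * N)) (QuantumGraph.TraceIndex N) ℂ) :
    QuantumGraph.IsSelfAdjointRealization G hbar c m (QuantumGraph.diracOp G hbar c m A B) ↔
      (Matrix.fromCols A B).rank = 4 * N ∧
        A * Matrix.conjTranspose B = B * Matrix.conjTranspose A := by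
  have hcard : Fintype.card (Fin (4 * N)) = Fintype.card (QuantumGraph.TraceIndex N) := by
    simp only [Fintype.card_fin, Fintype.card_prod]
    ring
  rw [QuantumGraph.isSelfAdjointRealization_diracOp_iff hhbar.ne' hc.ne',
    Matrix.ker_fromCols_lagrangian_iff A B hcard, Fintype.card_fin]
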